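/- Let $H$ be an infinite-dimensional complex Hilbert space (not necessarily separable), and let $\mathcal G_{\aleph_0}(H)$ be the set of all closed, separable, infinite-dimensional subspaces of $H$ whose codimension in $H$ is infinite. Let $h:\mathcal G_{\aleph_0}(H)\to\mathcal G_{\aleph_0}(H)$ be a bijection preserving orthogonality in both directions, i.e. for all $X,Y\in\mathcal G_{\aleph_0}(H)$, $$X\perp Y\iff h(X)\perp h(Y).$$ Then $h$ is induced by a unitary or anti-unitary operator: there is a unitary (linear surjective isometry) or anti-unitary (conjugate-linear surjective isometry) operator $U:H\to H$ such that $h(X)=U(X)$ for every $X\in\mathcal G_{\aleph_0}(H)$. -/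

import Mathlib

section HilbertGrassmannian

variable (H : Type*) [NormedAddCommGroup H] [InnerProductSpace ℂ H]

/-- The Grassmannian `𝒢_{ℵ₀}(H)`: the closed subspaces of `H` which are separable and
infinite-dimensional (i.e. have Hilbert dimension `ℵ₀`) and whose codimension is infinite. -/
def GrassmannianAlephZero : Type _ :=
  {X : Submodule ℂ H //
    IsClosed (X : Set H) ∧
    TopologicalSpace.IsSeparable (X : Set H) ∧
    ¬ FiniteDimensional ℂ X ∧
    ¬ FiniteDimensional ℂ (H ⧸ X)}

variable {H}

/-- The transformation `h` preserves the orthogonality relation in both directions: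
`X ⟂ Y` if and only if `h X ⟂ h Y`. -/
def PreservesOrthogonality (h : GrassmannianAlephZero H → GrassmannianAlephZero H) : Prop :=
  ∀ X Y : GrassmannianAlephZero H, X.1 ⟂ Y.1 ↔ (h X).1 ⟂ (h Y).1

/-- The transformation `h` is induced by a map `U : H → H`: `h X = U(X)` for every `X`. -/
def IsInducedBy (h : GrassmannianAlephZero H → GrassmannianAlephZero H) (U : H → H) : Prop :=
  ∀ X : GrassmannianAlephZero H, ((h X).1 : Set H) = U '' (X.1 : Set H)

end HilbertGrassmannian

/-!
The proof reduces the Grassmannian to the lines of `H`, and then determines the orthogonality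
preserving bijections of lines.

**From the Grassmannian to lines.** For members of the Grassmannian, `X ≤ Y` holds iff every member
orthogonal to `Y` is orthogonal to `X` (`GrassmannianAlephZero.le_iff_forall_ortho`), so `h` is an
order automorphism. If `v ≠ 0` is orthogonal to a member `Y`, then `Y ⊔ span {v}` covers `Y`, hence
its image covers `h Y`, and the orthogonal complement of `h Y` in it is a line. This line depends on
`v` only (`lineImage_eq`): it does not change when `Y` is enlarged by a member orthogonal to `Y` and
to `v`, because the latter has an image orthogonal to that of `Y ⊔ span {v}`; and any two choices of
`Y` are connected by such steps, through infinite-dimensional parts of them which are orthogonal to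
each other. The same construction for the inverse of `h` inverts the map of lines, which therefore
preserves orthogonality and incidence with members of the Grassmannian in both directions
(`PreservesOrthogonality.exists_isOrthoBijection`).

**From lines to an operator.** A bijection of lines preserving orthogonality preserves collinearity.
Fix a unit vector `e` with image line spanned by a unit vector `f`. Lines not orthogonal to `e` are
spanned by vectors `e + x` with `x ⟂ e`, and the image line is spanned by some `f + T x`. Since
`1 + ⟪x, y⟫ = 0` iff `1 + ⟪T x, T y⟫ = 0`, and since `T` is additive on orthogonal vectors, the
number `⟪T x, T y⟫` is a function `F` of `⟪x, y⟫` (`IsAffineChart.inner_map_eq_sub`). This function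
turns out to be a ring endomorphism of `ℂ` commuting with conjugation
(`IsAffineChart.exists_ringHom`), hence it maps `ℝ` to `ℝ` and is the identity or the conjugation.
The operator `a • e + x ↦ F a • f + T x` is then unitary or anti-unitary and induces the map of
lines (`IsOrthoBijection.exists_linearIsometryEquiv`).
-/

open scoped InnerProductSpace

/-! ### Orthogonal complements of finite-dimensional subspaces -/

section InfiniteDimensional

variable {H : Type*} [NormedAddCommGroup H] [InnerProductSpace ℂ H]

/-- The orthogonal projection to `K`, restricted to `Y`, has finite-dimensional range and kernel
`Y ⊓ Kᗮ`. -/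
theorem not_finiteDimensional_inf_orthogonal {Y K : Submodule ℂ H}
    (hY : ¬ FiniteDimensional ℂ Y) [FiniteDimensional ℂ K] :
    ¬ FiniteDimensional ℂ (Y ⊓ Kᗮ : Submodule ℂ H) := by
  intro hfin
  apply hY
  let f : Y →ₗ[ℂ] K := (K.orthogonalProjectionOnto : H →ₗ[ℂ] K) ∘ₗ Y.subtype
  have hle : (LinearMap.ker f).map Y.subtype ≤ Y ⊓ Kᗮ := by
    rintro _ ⟨y, hy, rfl⟩
    refine ⟨y.2, ?_⟩
    have : K.orthogonalProjectionOnto (y : H) = 0 := by simpa [f] using hy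
    simpa using this
  have : FiniteDimensional ℂ ((LinearMap.ker f).map Y.subtype) :=
    Submodule.finiteDimensional_of_le hle
  have : FiniteDimensional ℂ (LinearMap.ker f) :=
    ((LinearMap.ker f).equivMapOfInjective Y.subtype Y.injective_subtype).symm.finiteDimensional
  have : FiniteDimensional ℂ (Y ⧸ LinearMap.ker f) :=
    f.quotKerEquivRange.symm.finiteDimensional
  exact Module.Finite.of_submodule_quotient (LinearMap.ker f)

theorem not_finiteDimensional_orthogonal_of_finiteDimensional (hH : ¬ FiniteDimensional ℂ H)
    (K : Submodule ℂ H) [FiniteDimensional ℂ K] : ¬ FiniteDimensional ℂ Kᗮ := by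
  have htop : ¬ FiniteDimensional ℂ (⊤ : Submodule ℂ H) := fun h =>
    hH (Submodule.topEquiv.finiteDimensional)
  have h := not_finiteDimensional_inf_orthogonal htop (K := K)
  rwa [top_inf_eq] at h

theorem exists_ne_zero_mem_forall_inner_eq_zero {Y : Submodule ℂ H}
    (hY : ¬ FiniteDimensional ℂ Y) {s : Set H} (hs : s.Finite) :
    ∃ y ∈ Y, y ≠ 0 ∧ ∀ x ∈ s, ⟪x, y⟫_ℂ = 0 := by
  have : FiniteDimensional ℂ (Submodule.span ℂ s) := FiniteDimensional.span_of_finite ℂ hs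
  have h := not_finiteDimensional_inf_orthogonal hY (K := Submodule.span ℂ s)
  have hne : Y ⊓ (Submodule.span ℂ s)ᗮ ≠ ⊥ := by
    intro h0
    rw [h0] at h
    exact h inferInstance
  obtain ⟨y, hy, hy0⟩ := Submodule.exists_mem_ne_zero_of_ne_bot hne
  exact ⟨y, hy.1, hy0, fun x hx => hy.2 x (Submodule.subset_span hx)⟩

theorem exists_norm_eq_one_forall_inner_eq_zero (hH : ¬ FiniteDimensional ℂ H)
    {s : Set H} (hs : s.Finite) : ∃ z : H, ‖z‖ = 1 ∧ ∀ x ∈ s, ⟪x, z⟫_ℂ = 0 := by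
  have htop : ¬ FiniteDimensional ℂ (⊤ : Submodule ℂ H) := fun h =>
    hH (Submodule.topEquiv.finiteDimensional)
  obtain ⟨y, -, hy0, hy⟩ := exists_ne_zero_mem_forall_inner_eq_zero htop hs
  refine ⟨((‖y‖⁻¹ : ℝ) : ℂ) • y, ?_, fun x hx => by rw [inner_smul_right, hy x hx, mul_zero]⟩
  rw [norm_smul]
  simp [norm_ne_zero_iff.mpr hy0]

end InfiniteDimensional

/-! ### Ring endomorphisms of `ℂ` commuting with conjugation -/

section RingHom

/-- No continuity is needed here: such an endomorphism maps `ℝ` to `ℝ`, and the identity is the only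
ring endomorphism of `ℝ`. -/
theorem Complex.ringHom_eq_id_or_conj_of_map_conj (F : ℂ →+* ℂ)
    (hF : ∀ a, F (starRingEnd ℂ a) = starRingEnd ℂ (F a)) :
    (∀ a, F a = a) ∨ (∀ a, F a = starRingEnd ℂ a) := by
  have him : ∀ r : ℝ, (F r).im = 0 := fun r => by
    have := hF r
    rw [Complex.conj_ofReal] at this
    exact Complex.conj_eq_iff_im.mp this.symm
  let φ : ℝ →+* ℝ :=
    { toFun := fun r => (F r).re
      map_zero' := by simp
      map_one' := by simp
      map_add' := fun a b => by simp
      map_mul' := fun a b => by simp [him] }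
  have hreal : ∀ r : ℝ, F r = r := fun r => by
    have h1 : φ r = r := by
      rw [Subsingleton.elim φ (RingHom.id ℝ)]; rfl
    exact Complex.ext h1 (by simpa using him r)
  let A : ℂ →ₐ[ℝ] ℂ := { F with commutes' := fun r => by simpa using hreal r }
  rcases Complex.real_algHom_eq_id_or_conj A with h | h
  · exact Or.inl fun a => DFunLike.congr_fun h a
  · exact Or.inr fun a => DFunLike.congr_fun h a

end RingHom

/-! ### Maps of lines preserving orthogonality -/

section Uhlhorn

variable {H : Type*} [NormedAddCommGroup H] [InnerProductSpace ℂ H]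

/-- A bijection of the projective space of `H` preserving orthogonality in both directions, encoded
by a choice `g` of representatives: `g v` spans the image of the line spanned by `v`, and `g` takes
the value `0` at `0` only. Injectivity on lines follows from the two fields. -/
structure IsOrthoBijection (g : H → H) : Prop where
  inner_eq_zero_iff : ∀ v w, ⟪g v, g w⟫_ℂ = 0 ↔ ⟪v, w⟫_ℂ = 0
  exists_eq_smul : ∀ w, ∃ v, ∃ c : ℂ, c ≠ 0 ∧ g v = c • w

namespace IsOrthoBijection

variable {g : H → H} (hg : IsOrthoBijection g)
include hg

theorem eq_zero_iff (v : H) : g v = 0 ↔ v = 0 := by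
  have := hg.inner_eq_zero_iff v v
  rwa [inner_self_eq_zero, inner_self_eq_zero] at this

/-- An orthogonality preserving bijection of lines is a collineation, since
`span {x, y} = {x, y}ᗮᗮ`. -/
theorem map_mem_span_pair {v x y : H} (hv : v ∈ Submodule.span ℂ {x, y}) :
    g v ∈ Submodule.span ℂ {g x, g y} := by
  have : FiniteDimensional ℂ (Submodule.span ℂ {g x, g y}) :=
    FiniteDimensional.span_of_finite ℂ (Set.toFinite _)
  rw [← Submodule.orthogonal_orthogonal (Submodule.span ℂ {g x, g y})]
  intro w hw
  obtain ⟨u, c, hc, hu⟩ := hg.exists_eq_smul w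
  have key : ∀ t, ⟪w, g t⟫_ℂ = 0 ↔ ⟪u, t⟫_ℂ = 0 := fun t => by
    rw [← hg.inner_eq_zero_iff u, hu, inner_smul_left]
    simp [hc]
  have hx : ⟪u, x⟫_ℂ = 0 := (key x).mp
    (Submodule.inner_left_of_mem_orthogonal (Submodule.subset_span (by simp)) hw)
  have hy : ⟪u, y⟫_ℂ = 0 := (key y).mp
    (Submodule.inner_left_of_mem_orthogonal (Submodule.subset_span (by simp)) hw)
  obtain ⟨a, b, rfl⟩ := Submodule.mem_span_pair.mp hv
  rw [key, inner_add_right, inner_smul_right, inner_smul_right, hx, hy]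
  simp

theorem exists_map_smul {a : ℂ} (ha : a ≠ 0) (x : H) : ∃ c : ℂ, c ≠ 0 ∧ g (a • x) = c • g x := by
  have h : g (a • x) ∈ Submodule.span ℂ {g x, g x} :=
    hg.map_mem_span_pair (Submodule.mem_span_pair.mpr ⟨a, 0, by simp⟩)
  obtain ⟨b, c, hbc⟩ := Submodule.mem_span_pair.mp h
  rw [← add_smul] at hbc
  by_cases hx : x = 0
  · refine ⟨1, one_ne_zero, ?_⟩
    rw [hx, smul_zero, one_smul]
  · refine ⟨b + c, fun h0 => ?_, hbc.symm⟩
    rw [h0, zero_smul] at hbc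
    exact smul_ne_zero ha hx ((hg.eq_zero_iff _).mp hbc.symm)

end IsOrthoBijection

/-- Let `e` be a unit vector. A line not orthogonal to `e` is spanned by a unique `e + x` with
`x ⟂ e`, and if `g` represents an orthogonality preserving bijection and `f` spans the image of
`e`, then the image of that line is spanned by a unique `f + t` with `t ⟂ f`. The map `T` sends `x`
to `t`; its values at vectors not orthogonal to `e` are irrelevant. -/
structure IsAffineChart (g : H → H) (e f : H) (T : H → H) : Prop where
  norm_source : ‖e‖ = 1
  norm_target : ‖f‖ = 1
  map_source : ∃ c : ℂ, c ≠ 0 ∧ g e = c • f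
  inner_target : ∀ x, ⟪e, x⟫_ℂ = 0 → ⟪f, T x⟫_ℂ = 0
  map_add : ∀ x, ⟪e, x⟫_ℂ = 0 → ∃ c : ℂ, c ≠ 0 ∧ g (e + x) = c • (f + T x)

theorem inner_self_of_norm_eq_one {f : H} (hf : ‖f‖ = 1) : ⟪f, f⟫_ℂ = 1 := by
  rw [inner_self_eq_norm_sq_to_K, hf]; simp

theorem eq_of_smul_add_eq {f w w' : H} (hf : ‖f‖ = 1) (hw : ⟪f, w⟫_ℂ = 0) (hw' : ⟪f, w'⟫_ℂ = 0)
    {c c' : ℂ} (hc : c ≠ 0) (h : c • (f + w) = c' • (f + w')) : w = w' := by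
  have h1 := congrArg (fun t => ⟪f, t⟫_ℂ) h
  simp only [inner_smul_right, inner_add_right, hw, hw', inner_self_of_norm_eq_one hf] at h1
  obtain rfl : c = c' := by simpa using h1
  exact add_left_cancel (smul_right_injective H hc h)

theorem IsOrthoBijection.exists_isAffineChart {g : H → H} (hg : IsOrthoBijection g) {e : H}
    (he : ‖e‖ = 1) : ∃ f T, IsAffineChart g e f T := by
  have he0 : g e ≠ 0 := by
    rw [Ne, hg.eq_zero_iff, ← norm_eq_zero, he]; exact one_ne_zero
  have hn : ((‖g e‖ : ℝ) : ℂ) ≠ 0 := by simpa using he0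
  set f : H := ((‖g e‖ : ℝ) : ℂ)⁻¹ • g e with hf
  have hgf : g e = ((‖g e‖ : ℝ) : ℂ) • f := by rw [hf, smul_inv_smul₀ hn]
  have hfn : ‖f‖ = 1 := by
    rw [hf, norm_smul]; simp [he0]
  have hT : ∀ x, ∃ t, ⟪e, x⟫_ℂ = 0 → ⟪f, t⟫_ℂ = 0 ∧ ∃ c : ℂ, c ≠ 0 ∧ g (e + x) = c • (f + t) := by
    intro x
    by_cases hx : ⟪e, x⟫_ℂ = 0
    · have hne : ⟪f, g (e + x)⟫_ℂ ≠ 0 := by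
        rw [hf, inner_smul_left]
        refine mul_ne_zero (by simpa using he0) ?_
        rw [Ne, hg.inner_eq_zero_iff, inner_add_right, hx, inner_self_of_norm_eq_one he]
        simp
      refine ⟨(⟪f, g (e + x)⟫_ℂ)⁻¹ • g (e + x) - f, fun _ => ⟨?_, ⟪f, g (e + x)⟫_ℂ, hne, ?_⟩⟩
      · rw [inner_sub_right, inner_smul_right, inv_mul_cancel₀ hne, inner_self_of_norm_eq_one hfn,
          sub_self]
      · rw [add_sub_cancel, smul_inv_smul₀ hne]
    · exact ⟨0, fun h => absurd h hx⟩
  choose T hT using hT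
  exact ⟨f, T, he, hfn, ⟨_, hn, hgf⟩, fun x hx => (hT x hx).1, fun x hx => (hT x hx).2⟩

namespace IsAffineChart

variable {g : H → H} {e f : H} {T : H → H} (hg : IsOrthoBijection g) (hT : IsAffineChart g e f T)
include hg hT

omit hg in
theorem map_zero : T 0 = 0 := by
  obtain ⟨c, hc, h⟩ := hT.map_source
  obtain ⟨c', hc', h'⟩ := hT.map_add 0 (inner_zero_right _)
  rw [add_zero] at h'
  refine eq_of_smul_add_eq hT.norm_target (hT.inner_target 0 (inner_zero_right _))
    (inner_zero_right _) hc' (c' := c) ?_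
  rw [← h', h, add_zero]

/-- On the hyperplane at infinity the map of lines is given by `T` too, because
`x ∈ span {e + x, e}`. -/
theorem exists_map_eq_smul {x : H} (hx : ⟪e, x⟫_ℂ = 0) : ∃ c : ℂ, c ≠ 0 ∧ g x = c • T x := by
  obtain ⟨c, hc, h⟩ := hT.map_source
  obtain ⟨c', hc', h'⟩ := hT.map_add x hx
  have hmem : g x ∈ Submodule.span ℂ {g (e + x), g e} :=
    hg.map_mem_span_pair (Submodule.mem_span_pair.mpr ⟨1, -1, by module⟩)
  obtain ⟨a, b, hab⟩ := Submodule.mem_span_pair.mp hmem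
  have h0 : ⟪f, g x⟫_ℂ = 0 := by
    have := (hg.inner_eq_zero_iff e x).mpr hx
    rw [h, inner_smul_left] at this
    simpa [hc] using this
  rw [h, h'] at hab
  have h1 : a * c' + b * c = 0 := by
    rw [← hab] at h0
    simpa only [inner_add_right, inner_smul_right, hT.inner_target x hx, mul_one, add_zero,
      inner_self_of_norm_eq_one hT.norm_target] using h0
  have h2 : g x = (a * c') • T x := by
    have h3 : g x = (a * c' + b * c) • f + (a * c') • T x := by rw [← hab]; module
    rwa [h1, zero_smul, zero_add] at h3
  by_cases hx0 : x = 0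
  · refine ⟨1, one_ne_zero, ?_⟩
    rw [hx0, hT.map_zero, smul_zero, hg.eq_zero_iff]
  · refine ⟨a * c', fun h4 => hx0 ?_, h2⟩
    rwa [h4, zero_smul, hg.eq_zero_iff] at h2

theorem inner_eq_zero_iff {x y : H} (hx : ⟪e, x⟫_ℂ = 0) (hy : ⟪e, y⟫_ℂ = 0) :
    ⟪T x, T y⟫_ℂ = 0 ↔ ⟪x, y⟫_ℂ = 0 := by
  obtain ⟨c, hc, h⟩ := hT.exists_map_eq_smul hg hx
  obtain ⟨d, hd, h'⟩ := hT.exists_map_eq_smul hg hy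
  rw [← hg.inner_eq_zero_iff x, h, h', inner_smul_left, inner_smul_right]
  simp [hc, hd]

theorem one_add_inner_eq_zero_iff {x y : H} (hx : ⟪e, x⟫_ℂ = 0) (hy : ⟪e, y⟫_ℂ = 0) :
    1 + ⟪T x, T y⟫_ℂ = 0 ↔ 1 + ⟪x, y⟫_ℂ = 0 := by
  obtain ⟨c, hc, h⟩ := hT.map_add x hx
  obtain ⟨d, hd, h'⟩ := hT.map_add y hy
  have key : ∀ {e x y : H}, ‖e‖ = 1 → ⟪e, x⟫_ℂ = 0 → ⟪e, y⟫_ℂ = 0 →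
      ⟪e + x, e + y⟫_ℂ = 1 + ⟪x, y⟫_ℂ := fun he hx hy => by
    rw [inner_add_left, inner_add_right, inner_add_right, hy, inner_eq_zero_symm.mp hx,
      inner_self_of_norm_eq_one he, add_zero, zero_add]
  rw [← key hT.norm_source hx hy, ← key hT.norm_target (hT.inner_target x hx) (hT.inner_target y hy),
    ← hg.inner_eq_zero_iff (e + x), h, h', inner_smul_left, inner_smul_right]
  simp only [mul_eq_zero, map_eq_zero, hc, hd, false_or]

/-- For `x ⟂ y` the vector `T (x + y)` lies in `T x + span {T y}` and in `T y + span {T x}`, by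
collinearity, and these two affine lines meet in `T x + T y` only. -/
theorem map_add_eq {x y : H} (hx : ⟪e, x⟫_ℂ = 0) (hy : ⟪e, y⟫_ℂ = 0) (hxy : ⟪x, y⟫_ℂ = 0) :
    T (x + y) = T x + T y := by
  have hxy' : ⟪e, x + y⟫_ℂ = 0 := by rw [inner_add_right, hx, hy, add_zero]
  have key : ∀ {x y : H}, ⟪e, x⟫_ℂ = 0 → ⟪e, y⟫_ℂ = 0 → ∃ b : ℂ, T (x + y) = T x + b • T y := by
    intro x y hx hy
    have hxy' : ⟪e, x + y⟫_ℂ = 0 := by rw [inner_add_right, hx, hy, add_zero]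
    obtain ⟨c, hc, h⟩ := hT.map_add x hx
    obtain ⟨d, hd, h'⟩ := hT.exists_map_eq_smul hg hy
    obtain ⟨k, hk, h''⟩ := hT.map_add (x + y) hxy'
    have hmem : g (e + (x + y)) ∈ Submodule.span ℂ {g (e + x), g y} :=
      hg.map_mem_span_pair (Submodule.mem_span_pair.mpr ⟨1, 1, by module⟩)
    obtain ⟨a, b, hab⟩ := Submodule.mem_span_pair.mp hmem
    rw [h, h', h''] at hab
    have h1 := congrArg (fun t => ⟪f, t⟫_ℂ) hab
    simp only [inner_smul_right, inner_add_right, hT.inner_target _ hx, hT.inner_target _ hy,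
      hT.inner_target _ hxy', inner_self_of_norm_eq_one hT.norm_target] at h1
    have h2 : a * c = k := by simpa using h1
    refine ⟨k⁻¹ * b * d, ?_⟩
    refine eq_of_smul_add_eq hT.norm_target (hT.inner_target _ hxy') ?_ hk (c' := k) ?_
    · rw [inner_add_right, inner_smul_right, hT.inner_target _ hx, hT.inner_target _ hy, mul_zero,
        add_zero]
    · rw [← hab, ← h2, smul_smul, smul_smul, h2, smul_add, smul_add, smul_add, smul_smul,
        ← mul_assoc, ← mul_assoc, mul_inv_cancel₀ hk]
      module
  obtain ⟨b, hb⟩ := key hx hy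
  obtain ⟨b', hb'⟩ := key hy hx
  rw [add_comm y x] at hb'
  have hT0 : ⟪T y, T x⟫_ℂ = 0 := (hT.inner_eq_zero_iff hg hy hx).mpr (inner_eq_zero_symm.mp hxy)
  have h1 : ⟪T y, b • T y - T y⟫_ℂ = 0 := by
    have : b • T y - T y = b' • T x - T x := by
      have h2 := hb.symm.trans hb'
      rw [sub_eq_sub_iff_add_eq_add, add_comm, h2, add_comm]
    rw [this, inner_sub_right, inner_smul_right, hT0]; simp
  have h2 : b • T y - T y = 0 := by
    have h3 : b • T y - T y = (b - 1) • T y := by module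
    rw [h3, inner_smul_right, mul_eq_zero, inner_self_eq_zero] at h1
    rw [h3, smul_eq_zero]; exact h1
  rw [hb, sub_eq_zero.mp h2]

/-- The inner product `⟪T x, T y⟫` depends on `⟪x, y⟫` only: if `z` is orthogonal to `x` and `y` and
`1 + ⟪x, y⟫ + s = 0`, then `e + x + z` is orthogonal to `e + y + s • z`, and this relation is
preserved. -/
theorem inner_map_eq_sub {x y z : H} (hx : ⟪e, x⟫_ℂ = 0) (hy : ⟪e, y⟫_ℂ = 0)
    (hz : ⟪e, z⟫_ℂ = 0) (hz1 : ‖z‖ = 1) (hxz : ⟪x, z⟫_ℂ = 0) (hyz : ⟪y, z⟫_ℂ = 0) :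
    ⟪T x, T y⟫_ℂ = -1 - ⟪T z, T ((-1 - ⟪x, y⟫_ℂ) • z)⟫_ℂ := by
  set s : ℂ := -1 - ⟪x, y⟫_ℂ with hs
  have hsz : ⟪e, s • z⟫_ℂ = 0 := by rw [inner_smul_right, hz, mul_zero]
  have hxsz : ⟪x, s • z⟫_ℂ = 0 := by rw [inner_smul_right, hxz, mul_zero]
  have hysz : ⟪y, s • z⟫_ℂ = 0 := by rw [inner_smul_right, hyz, mul_zero]
  have hzy : ⟪z, y⟫_ℂ = 0 := inner_eq_zero_symm.mp hyz
  have h1 : 1 + ⟪x + z, y + s • z⟫_ℂ = 0 := by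
    rw [inner_add_left, inner_add_right, inner_add_right, hxsz, hzy, inner_smul_right,
      inner_self_of_norm_eq_one hz1, hs]
    ring
  rw [← hT.one_add_inner_eq_zero_iff hg (by rw [inner_add_right, hx, hz, add_zero])
    (by rw [inner_add_right, hy, hsz, add_zero]), hT.map_add_eq hg hx hz hxz,
    hT.map_add_eq hg hy hsz hysz, inner_add_left, inner_add_right, inner_add_right,
    (hT.inner_eq_zero_iff hg hx hsz).mpr hxsz, (hT.inner_eq_zero_iff hg hz hy).mpr hzy] at h1
  linear_combination h1

theorem exists_inner_map_eq (hH : ¬ FiniteDimensional ℂ H) : ∃ F : ℂ → ℂ,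
    ∀ x y, ⟪e, x⟫_ℂ = 0 → ⟪e, y⟫_ℂ = 0 → ⟪T x, T y⟫_ℂ = F ⟪x, y⟫_ℂ := by
  obtain ⟨z, hz1, hz⟩ := exists_norm_eq_one_forall_inner_eq_zero hH (Set.toFinite {e})
  have hez : ⟪e, z⟫_ℂ = 0 := hz e (by simp)
  refine ⟨fun s => ⟪T z, T (s • z)⟫_ℂ, fun x y hx hy => ?_⟩
  obtain ⟨w, hw1, hw⟩ := exists_norm_eq_one_forall_inner_eq_zero hH (Set.toFinite {e, x, y, z})
  have hzw : ⟪z, w⟫_ℂ = 0 := hw z (by simp)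
  have h2 := hT.inner_map_eq_sub hg hez (y := ⟪x, y⟫_ℂ • z) (z := w)
    (by rw [inner_smul_right, hez, mul_zero]) (hw e (by simp)) hw1 hzw
    (by rw [inner_smul_left, hzw, mul_zero])
  rw [inner_smul_right, inner_self_of_norm_eq_one hz1, mul_one] at h2
  rw [hT.inner_map_eq_sub hg hx hy (hw e (by simp)) hw1 (hw x (by simp)) (hw y (by simp)), ← h2]

/-- The function `F` with `⟪T x, T y⟫ = F ⟪x, y⟫` is a ring homomorphism. Additivity comes from two
orthogonal unit vectors, `F (-1) = -1` from the preservation of `1 + ⟪x, y⟫ = 0`, and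
multiplicativity from evaluating `⟪T (a • z), T (b • z)⟫` on a single line. -/
theorem exists_ringHom (hH : ¬ FiniteDimensional ℂ H) : ∃ F : ℂ →+* ℂ,
    (∀ a, F (starRingEnd ℂ a) = starRingEnd ℂ (F a)) ∧
    (∀ x y, ⟪e, x⟫_ℂ = 0 → ⟪e, y⟫_ℂ = 0 → ⟪T x, T y⟫_ℂ = F ⟪x, y⟫_ℂ) ∧
    ∀ a x, ⟪e, x⟫_ℂ = 0 → T (a • x) = F a • T x := by
  obtain ⟨F, hF⟩ := hT.exists_inner_map_eq hg hH
  obtain ⟨z, hz1, hz⟩ := exists_norm_eq_one_forall_inner_eq_zero hH (Set.toFinite {e})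
  obtain ⟨w, hw1, hw⟩ := exists_norm_eq_one_forall_inner_eq_zero hH (Set.toFinite {e, z})
  have hez : ⟪e, z⟫_ℂ = 0 := hz e (by simp)
  have hew : ⟪e, w⟫_ℂ = 0 := hw e (by simp)
  have hzw : ⟪z, w⟫_ℂ = 0 := hw z (by simp)
  have hwz : ⟪w, z⟫_ℂ = 0 := inner_eq_zero_symm.mp hzw
  have hes : ∀ (a : ℂ) {x : H}, ⟪e, x⟫_ℂ = 0 → ⟪e, a • x⟫_ℂ = 0 := fun a x hx => by
    rw [inner_smul_right, hx, mul_zero]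
  have hFz : ∀ a b : ℂ, ⟪T (a • z), T (b • z)⟫_ℂ = F (starRingEnd ℂ a * b) := fun a b => by
    rw [hF _ _ (hes a hez) (hes b hez), inner_smul_left, inner_smul_right,
      inner_self_of_norm_eq_one hz1, mul_one]
  have hF0 : F 0 = 0 := by
    have h1 := (hT.inner_eq_zero_iff hg hez hew).mpr hzw
    rwa [hF _ _ hez hew, hzw] at h1
  have hadd : ∀ a b, F (a + b) = F a + F b := fun a b => by
    have h1 : ⟪z + w, a • z + b • w⟫_ℂ = a + b := by
      rw [inner_add_left, inner_add_right, inner_add_right]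
      simp only [inner_smul_right, hzw, hwz, inner_self_of_norm_eq_one hz1,
        inner_self_of_norm_eq_one hw1]
      ring
    have hza : ⟪z, b • w⟫_ℂ = 0 := by rw [inner_smul_right, hzw, mul_zero]
    have hwa : ⟪w, a • z⟫_ℂ = 0 := by rw [inner_smul_right, hwz, mul_zero]
    rw [← h1, ← hF _ _ (by rw [inner_add_right, hez, hew, add_zero])
      (by rw [inner_add_right, hes a hez, hes b hew, add_zero]), hT.map_add_eq hg hez hew hzw,
      hT.map_add_eq hg (hes a hez) (hes b hew)
        (by rw [inner_smul_left, inner_smul_right, hzw, mul_zero, mul_zero]),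
      inner_add_left, inner_add_right, inner_add_right, hF _ _ hez (hes b hew), hza,
      hF _ _ hew (hes a hez), hwa, hF0, hF _ _ hez (hes a hez), hF _ _ hew (hes b hew),
      inner_smul_right, inner_smul_right, inner_self_of_norm_eq_one hz1,
      inner_self_of_norm_eq_one hw1, mul_one, mul_one, add_zero, zero_add]
  -- This is injectivity of `F`, as `F` is additive.
  have hinj : ∀ a, F a = 0 → a = 0 := fun a ha => by
    have h1 := hFz 1 a
    rw [map_one, one_mul, ha, hT.inner_eq_zero_iff hg (hes 1 hez) (hes a hez), one_smul,
      inner_smul_right, inner_self_of_norm_eq_one hz1, mul_one] at h1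
    exact h1
  have hone : F 1 = 1 := by
    have h1 : 1 + F (-1) = 0 := by
      have h2 : ⟪z, (-1 : ℂ) • z⟫_ℂ = -1 := by
        rw [inner_smul_right, inner_self_of_norm_eq_one hz1, mul_one]
      rw [← h2, ← hF _ _ hez (hes _ hez), hT.one_add_inner_eq_zero_iff hg hez (hes _ hez), h2]
      ring
    have h3 := hadd 1 (-1)
    rw [add_neg_cancel, hF0] at h3
    linear_combination -h1 - h3
  have hconj : ∀ a, F (starRingEnd ℂ a) = starRingEnd ℂ (F a) := fun a => by
    have h1 := hFz a 1
    have h2 := hFz 1 a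
    rw [mul_one] at h1
    rw [map_one, one_mul] at h2
    rw [← h1, ← h2, inner_conj_symm]
  have hmulz : ∀ (a : ℂ) x, ⟪e, x⟫_ℂ = 0 → ∃ c : ℂ, T (a • x) = c • T x := fun a x hx => by
    by_cases ha : a = 0
    · exact ⟨0, by rw [ha, zero_smul, zero_smul, hT.map_zero]⟩
    · obtain ⟨c, hc, h⟩ := hg.exists_map_smul ha x
      obtain ⟨d, hd, h'⟩ := hT.exists_map_eq_smul hg hx
      obtain ⟨k, hk, h''⟩ := hT.exists_map_eq_smul hg (hes a hx)
      refine ⟨k⁻¹ * (c * d), ?_⟩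
      rw [mul_smul, mul_smul, ← h', ← h, h'', inv_smul_smul₀ hk]
  have hTz : ∀ a, T (a • z) = F a • T z := fun a => by
    obtain ⟨c, hc⟩ := hmulz a z hez
    have h1 := hFz 1 a
    have h2 := hFz 1 1
    rw [one_smul, map_one, one_mul] at h1 h2
    rw [hone] at h2
    rw [hc, inner_smul_right, h2, mul_one] at h1
    rw [hc, h1]
  have hmul : ∀ a b, F (a * b) = F a * F b := fun a b => by
    have h1 := hFz (starRingEnd ℂ a) b
    have h2 := hFz 1 1
    rw [one_smul, map_one, one_mul, hone] at h2
    rw [hTz, hTz, inner_smul_left, inner_smul_right, h2, hconj, Complex.conj_conj,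
      Complex.conj_conj, mul_one] at h1
    exact h1.symm
  refine ⟨⟨⟨⟨F, hone⟩, hmul⟩, hF0, hadd⟩, hconj, hF, fun a x hx => ?_⟩
  obtain ⟨c, hc⟩ := hmulz a x hx
  by_cases hx0 : x = 0
  · rw [hx0, smul_zero, hT.map_zero, smul_zero]
  · have h1 := hF x (a • x) hx (hes a hx)
    rw [hc, inner_smul_right, inner_smul_right, hF x x hx hx, hmul] at h1
    have h2 : F ⟪x, x⟫_ℂ ≠ 0 := fun h => hx0 (inner_self_eq_zero.mp (hinj _ h))
    rw [hc, mul_right_cancel₀ h2 h1]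
    rfl

end IsAffineChart

/-- A surjection transforming inner products by `σ` is automatically `σ`-semilinear, because the
vectors `U z` separate points. -/
theorem exists_linearIsometryEquiv_of_inner_map {σ : ℂ →+* ℂ} [RingHomInvPair σ σ]
    (hσ : ∀ a, ‖σ a‖ = ‖a‖) {U : H → H} (hU : Function.Surjective U)
    (hin : ∀ x y, ⟪U x, U y⟫_ℂ = σ ⟪x, y⟫_ℂ) : ∃ V : H ≃ₛₗᵢ[σ] H, ∀ x, V x = U x := by
  have hext : ∀ {a b : H}, (∀ z, ⟪U z, a⟫_ℂ = ⟪U z, b⟫_ℂ) → a = b := fun {a b} h => by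
    refine ext_inner_left ℂ fun v => ?_
    obtain ⟨z, rfl⟩ := hU v
    exact h z
  have hnorm : ∀ x, ‖U x‖ = ‖x‖ := fun x => by
    have h1 := congrArg norm (hin x x)
    rw [hσ, inner_self_eq_norm_sq_to_K, inner_self_eq_norm_sq_to_K] at h1
    simpa using h1
  let L : H →ₛₗ[σ] H :=
    { toFun := U
      map_add' := fun x y => hext fun z => by
        rw [inner_add_right, hin, hin, hin, inner_add_right, map_add]
      map_smul' := fun a x => hext fun z => by
        rw [inner_smul_right, hin, hin, inner_smul_right, map_mul] }
  exact ⟨LinearIsometryEquiv.ofSurjective ⟨L, hnorm⟩ hU, fun _ => rfl⟩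

/-- The chart extends to `H` by `U (a • e + x) = F a • f + T x` for `x ⟂ e`. -/
theorem IsAffineChart.exists_surjective_inner_map {g : H → H} (hg : IsOrthoBijection g)
    {e f : H} {T : H → H} (hT : IsAffineChart g e f T) {F : ℂ →+* ℂ}
    (hF : ∀ x y, ⟪e, x⟫_ℂ = 0 → ⟪e, y⟫_ℂ = 0 → ⟪T x, T y⟫_ℂ = F ⟪x, y⟫_ℂ)
    (hconj : ∀ a, F (starRingEnd ℂ a) = starRingEnd ℂ (F a))
    (hsmul : ∀ a x, ⟪e, x⟫_ℂ = 0 → T (a • x) = F a • T x)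
    (hsurj : Function.Surjective F) :
    ∃ U : H → H, Function.Surjective U ∧ (∀ x y, ⟪U x, U y⟫_ℂ = F ⟪x, y⟫_ℂ) ∧
      ∀ v, ∃ c : ℂ, c ≠ 0 ∧ U v = c • g v := by
  have he := inner_self_of_norm_eq_one hT.norm_source
  have hf := inner_self_of_norm_eq_one hT.norm_target
  set r : H → H := fun v => v - ⟪e, v⟫_ℂ • e with hr
  have hre : ∀ v, ⟪e, r v⟫_ℂ = 0 := fun v => by
    simp only [hr, inner_sub_right, inner_smul_right, he]; ring
  have hrv : ∀ v, v = ⟪e, v⟫_ℂ • e + r v := fun v => by simp [hr]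
  have hr_of : ∀ (a : ℂ) {x : H}, ⟪e, x⟫_ℂ = 0 → ⟪e, a • e + x⟫_ℂ = a ∧ r (a • e + x) = x :=
    fun a x hx => by
      have h1 : ⟪e, a • e + x⟫_ℂ = a := by
        rw [inner_add_right, inner_smul_right, he, hx]; ring
      exact ⟨h1, by simp only [hr, h1, add_sub_cancel_left]⟩
  have hTf : ∀ v, ⟪T (r v), f⟫_ℂ = 0 := fun v =>
    inner_eq_zero_symm.mp (hT.inner_target _ (hre v))
  refine ⟨fun v => F ⟪e, v⟫_ℂ • f + T (r v), fun w => ?_, fun x y => ?_, fun v => ?_⟩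
  · -- A vector `f + t` spans the image of some `e + x`, and then `T x = t`.
    have htsurj : ∀ t, ⟪f, t⟫_ℂ = 0 → ∃ x, ⟪e, x⟫_ℂ = 0 ∧ T x = t := by
      intro t ht
      obtain ⟨u, c, hc, hu⟩ := hg.exists_eq_smul (f + t)
      have ha : ⟪e, u⟫_ℂ ≠ 0 := by
        obtain ⟨d, hd, hd'⟩ := hT.map_source
        rw [Ne, ← hg.inner_eq_zero_iff, hd', hu, inner_smul_left, inner_smul_right,
          inner_add_right, hf, ht]
        simp [hc, hd]
      set x := (⟪e, u⟫_ℂ)⁻¹ • r u with hx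
      have hex : ⟪e, x⟫_ℂ = 0 := by rw [hx, inner_smul_right, hre, mul_zero]
      have hu' : u = ⟪e, u⟫_ℂ • (e + x) := by
        rw [smul_add, hx, smul_inv_smul₀ ha]; exact hrv u
      obtain ⟨k, hk, hk'⟩ := hT.map_add x hex
      obtain ⟨m, hm, hm'⟩ := hg.exists_map_smul ha (e + x)
      rw [← hu', hk', hu, smul_smul] at hm'
      exact ⟨x, hex, eq_of_smul_add_eq hT.norm_target (hT.inner_target x hex) ht
        (mul_ne_zero hm hk) hm'.symm⟩
    obtain ⟨a, ha⟩ := hsurj ⟪f, w⟫_ℂ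
    obtain ⟨x, hx, hxt⟩ := htsurj (w - ⟪f, w⟫_ℂ • f) (by
      rw [inner_sub_right, inner_smul_right, hf]; ring)
    refine ⟨a • e + x, ?_⟩
    simp only [(hr_of a hx).1, (hr_of a hx).2, ha, hxt, add_sub_cancel]
  · have h1 : ⟪x, y⟫_ℂ = starRingEnd ℂ ⟪e, x⟫_ℂ * ⟪e, y⟫_ℂ + ⟪r x, r y⟫_ℂ := by
      conv_lhs => rw [hrv x, hrv y]
      rw [inner_add_left, inner_add_right, inner_add_right, inner_smul_left, inner_smul_left,
        inner_smul_right, inner_smul_right, he, hre, inner_eq_zero_symm.mp (hre x)]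
      ring
    rw [h1, _root_.map_add, map_mul, hconj, ← hF _ _ (hre x) (hre y)]
    simp only [inner_add_left, inner_add_right, inner_smul_left, inner_smul_right, hTf,
      hT.inner_target _ (hre y), hf]
    ring
  · by_cases ha : ⟪e, v⟫_ℂ = 0
    · have hv : r v = v := by simp [hr, ha]
      obtain ⟨c, hc, h⟩ := hT.exists_map_eq_smul hg ha
      refine ⟨c⁻¹, inv_ne_zero hc, ?_⟩
      simp only [ha, hv, _root_.map_zero, zero_smul, zero_add, h, inv_smul_smul₀ hc]
    · set a := ⟪e, v⟫_ℂ with hadef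
      have hFa : F a ≠ 0 := (map_ne_zero F).mpr ha
      have hex : ⟪e, a⁻¹ • r v⟫_ℂ = 0 := by rw [inner_smul_right, hre, mul_zero]
      have hv' : v = a • (e + a⁻¹ • r v) := by
        rw [smul_add, smul_inv_smul₀ ha]; exact hrv v
      obtain ⟨k, hk, hk'⟩ := hT.map_add _ hex
      obtain ⟨m, hm, hm'⟩ := hg.exists_map_smul ha (e + a⁻¹ • r v)
      rw [← hv', hk', hsmul _ _ (hre v), map_inv₀, smul_smul] at hm'
      refine ⟨F a * (m * k)⁻¹, mul_ne_zero hFa (inv_ne_zero (mul_ne_zero hm hk)), ?_⟩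
      rw [hm', smul_smul, mul_assoc, inv_mul_cancel₀ (mul_ne_zero hm hk), mul_one, smul_add,
        smul_inv_smul₀ hFa]

/-- **Uhlhorn's theorem** in infinite dimension. -/
theorem IsOrthoBijection.exists_linearIsometryEquiv (hH : ¬ FiniteDimensional ℂ H) {g : H → H}
    (hg : IsOrthoBijection g) :
    (∃ U : H ≃ₗᵢ[ℂ] H, ∀ v, ∃ c : ℂ, c ≠ 0 ∧ U v = c • g v) ∨
      (∃ U : H ≃ₗᵢ⋆[ℂ] H, ∀ v, ∃ c : ℂ, c ≠ 0 ∧ U v = c • g v) := by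
  obtain ⟨e, he, -⟩ := exists_norm_eq_one_forall_inner_eq_zero hH (Set.toFinite ∅)
  obtain ⟨f, T, hT⟩ := hg.exists_isAffineChart he
  obtain ⟨F, hconj, hF, hsmul⟩ := hT.exists_ringHom hg hH
  rcases Complex.ringHom_eq_id_or_conj_of_map_conj F hconj with h | h
  · obtain ⟨U, hUs, hU, hUg⟩ := hT.exists_surjective_inner_map hg hF hconj hsmul
      fun a => ⟨a, h a⟩
    obtain ⟨V, hV⟩ := exists_linearIsometryEquiv_of_inner_map (σ := RingHom.id ℂ)
      (fun a => rfl) hUs fun x y => by rw [hU, h]; rfl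
    exact Or.inl ⟨V, fun v => by rw [hV]; exact hUg v⟩
  · obtain ⟨U, hUs, hU, hUg⟩ := hT.exists_surjective_inner_map hg hF hconj hsmul
      fun a => ⟨starRingEnd ℂ a, by rw [h, Complex.conj_conj]⟩
    obtain ⟨V, hV⟩ := exists_linearIsometryEquiv_of_inner_map (σ := starRingEnd ℂ)
      (fun a => by simp) hUs fun x y => by rw [hU, h]
    exact Or.inr ⟨V, fun v => by rw [hV]; exact hUg v⟩

end Uhlhorn

/-! ### Orthogonal sequences and their closed spans -/

section OrthogonalSequences

variable {H : Type*} [NormedAddCommGroup H] [InnerProductSpace ℂ H]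

theorem not_finiteDimensional_of_orthogonal_sequence {K : Submodule ℂ H} {u : ℕ → H}
    (hK : ∀ n, u n ∈ K) (hu0 : ∀ n, u n ≠ 0) (hu : Pairwise fun m n => ⟪u m, u n⟫_ℂ = 0) :
    ¬ FiniteDimensional ℂ K := by
  intro hfin
  have hli : LinearIndependent ℂ u := linearIndependent_of_ne_zero_of_inner_eq_zero hu0 hu
  have hli' : LinearIndependent ℂ fun n => (⟨u n, hK n⟩ : K) :=
    LinearIndependent.of_comp K.subtype hli
  exact not_finite_iff_infinite.mpr inferInstance hli'.finite

/-- The two sequences are chosen alternately, each new vector being orthogonal to the finitely many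
vectors chosen before. -/
theorem exists_orthogonal_sequences {Y Z : Submodule ℂ H} (hY : ¬ FiniteDimensional ℂ Y)
    (hZ : ¬ FiniteDimensional ℂ Z) : ∃ y z : ℕ → H,
      (∀ n, y n ∈ Y) ∧ (∀ n, y n ≠ 0) ∧ (∀ n, z n ∈ Z) ∧ (∀ n, z n ≠ 0) ∧
      (Pairwise fun m n => ⟪y m, y n⟫_ℂ = 0) ∧ (Pairwise fun m n => ⟪z m, z n⟫_ℂ = 0) ∧
      ∀ m n, ⟪y m, z n⟫_ℂ = 0 := by
  obtain ⟨u, hu, huu⟩ := exists_seq_of_forall_finset_exists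
    (fun p : H × H => (p.1 ∈ Y ∧ p.1 ≠ 0) ∧ (p.2 ∈ Z ∧ p.2 ≠ 0) ∧ ⟪p.1, p.2⟫_ℂ = 0)
    (fun p q => (⟪p.1, q.1⟫_ℂ = 0 ∧ ⟪p.2, q.1⟫_ℂ = 0) ∧ ⟪p.1, q.2⟫_ℂ = 0 ∧ ⟪p.2, q.2⟫_ℂ = 0)
    (fun s _ => by
      have hs : (⋃ p ∈ s, ({p.1, p.2} : Set H)).Finite :=
        s.finite_toSet.biUnion fun p _ => Set.toFinite _
      obtain ⟨y, hyY, hy0, hy⟩ := exists_ne_zero_mem_forall_inner_eq_zero hY hs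
      obtain ⟨z, hzZ, hz0, hz⟩ := exists_ne_zero_mem_forall_inner_eq_zero hZ (hs.insert y)
      have h1 : ∀ p ∈ s, p.1 ∈ ⋃ p ∈ s, ({p.1, p.2} : Set H) := fun p hp =>
        Set.mem_biUnion hp (by simp)
      have h2 : ∀ p ∈ s, p.2 ∈ ⋃ p ∈ s, ({p.1, p.2} : Set H) := fun p hp =>
        Set.mem_biUnion hp (by simp)
      exact ⟨(y, z), ⟨⟨hyY, hy0⟩, ⟨hzZ, hz0⟩, hz y (Set.mem_insert _ _)⟩, fun p hp =>
        ⟨⟨hy _ (h1 p hp), hy _ (h2 p hp)⟩, hz _ (Set.mem_insert_of_mem _ (h1 p hp)),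
          hz _ (Set.mem_insert_of_mem _ (h2 p hp))⟩⟩)
  refine ⟨fun n => (u n).1, fun n => (u n).2, fun n => (hu n).1.1, fun n => (hu n).1.2,
    fun n => (hu n).2.1.1, fun n => (hu n).2.1.2, fun m n hmn => ?_, fun m n hmn => ?_,
    fun m n => ?_⟩
  · rcases lt_or_gt_of_ne hmn with h | h
    · exact (huu m n h).1.1
    · exact inner_eq_zero_symm.mp (huu n m h).1.1
  · rcases lt_or_gt_of_ne hmn with h | h
    · exact (huu m n h).2.2
    · exact inner_eq_zero_symm.mp (huu n m h).2.2
  · rcases lt_trichotomy m n with h | rfl | h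
    · exact (huu m n h).2.1
    · exact (hu m).2.2
    · exact inner_eq_zero_symm.mp (huu n m h).1.2

/-- The closed linear span of a sequence of vectors. -/
def closedSpan (u : ℕ → H) : Submodule ℂ H := (Submodule.span ℂ (Set.range u)).topologicalClosure

theorem mem_closedSpan (u : ℕ → H) (n : ℕ) : u n ∈ closedSpan u :=
  Submodule.le_topologicalClosure _ (Submodule.subset_span ⟨n, rfl⟩)

theorem isSeparable_closedSpan (u : ℕ → H) :
    TopologicalSpace.IsSeparable (closedSpan u : Set H) := by
  rw [closedSpan, Submodule.topologicalClosure_coe]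
  exact ((Set.countable_range u).isSeparable.span (R := ℂ)).closure

theorem closedSpan_le {u : ℕ → H} {K : Submodule ℂ H} (hK : IsClosed (K : Set H))
    (hu : ∀ n, u n ∈ K) : closedSpan u ≤ K :=
  Submodule.topologicalClosure_minimal _
    (Submodule.span_le.mpr (Set.range_subset_iff.mpr hu)) hK

theorem mem_orthogonal_closedSpan {u : ℕ → H} {w : H} (hw : ∀ n, ⟪u n, w⟫_ℂ = 0) :
    w ∈ (closedSpan u)ᗮ := by
  have h : closedSpan u ≤ (ℂ ∙ w)ᗮ := closedSpan_le (Submodule.isClosed_orthogonal _) fun n =>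
    Submodule.mem_orthogonal_singleton_iff_inner_left.mpr (hw n)
  exact fun x hx => Submodule.mem_orthogonal_singleton_iff_inner_left.mp (h hx)

end OrthogonalSequences

/-! ### The Grassmannian: order, adjoining a vector, orthogonal members -/

namespace GrassmannianAlephZero

variable {H : Type*} [NormedAddCommGroup H] [InnerProductSpace ℂ H]

theorem isSeparable_sup {A B : Submodule ℂ H} (hA : TopologicalSpace.IsSeparable (A : Set H))
    (hB : TopologicalSpace.IsSeparable (B : Set H)) :
    TopologicalSpace.IsSeparable ((A ⊔ B : Submodule ℂ H) : Set H) := by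
  have h : A ⊔ B = Submodule.span ℂ ((A : Set H) ∪ B) := by
    rw [Submodule.span_union, Submodule.span_eq, Submodule.span_eq]
  rw [h]
  exact (hA.union hB).span

theorem isClosed_inf_orthogonal (X : GrassmannianAlephZero H) (K : Submodule ℂ H) :
    IsClosed ((X.1 ⊓ Kᗮ : Submodule ℂ H) : Set H) :=
  X.2.1.inter (Submodule.isClosed_orthogonal K)

variable [CompleteSpace H]

instance (X : GrassmannianAlephZero H) : CompleteSpace X.1 := X.2.1.completeSpace_coe

theorem not_finiteDimensional_orthogonal (X : GrassmannianAlephZero H) :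
    ¬ FiniteDimensional ℂ X.1ᗮ := fun _ =>
  X.2.2.2.2 (X.1.quotientEquivOfIsCompl _ X.1.isCompl_orthogonal).symm.finiteDimensional

/-- A member of the Grassmannian, the condition on the codimension being expressed by the
orthogonal complement. -/
def ofOrthogonal (X : Submodule ℂ H) (hc : IsClosed (X : Set H))
    (hs : TopologicalSpace.IsSeparable (X : Set H)) (hX : ¬ FiniteDimensional ℂ X)
    (hX' : ¬ FiniteDimensional ℂ Xᗮ) : GrassmannianAlephZero H :=
  ⟨X, hc, hs, hX, fun _ => hX' <| by
    have : CompleteSpace X := hc.completeSpace_coe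
    exact (X.quotientEquivOfIsCompl _ X.isCompl_orthogonal).finiteDimensional⟩

/-- The member `X ⊔ span {v}` of the Grassmannian. -/
def adjoin (X : GrassmannianAlephZero H) (v : H) : GrassmannianAlephZero H :=
  ofOrthogonal (X.1 ⊔ ℂ ∙ v) (Submodule.isClosed_sup_finiteDimensional _ _ X.2.1)
    (isSeparable_sup X.2.2.1 ((Set.countable_singleton v).isSeparable.span))
    (fun _ => X.2.2.2.1 (Submodule.finiteDimensional_of_le (le_sup_left (b := ℂ ∙ v))))
    (by
      rw [← Submodule.inf_orthogonal]
      exact not_finiteDimensional_inf_orthogonal X.not_finiteDimensional_orthogonal)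

theorem le_adjoin (X : GrassmannianAlephZero H) (v : H) : X.1 ≤ (X.adjoin v).1 :=
  le_sup_left (b := ℂ ∙ v)

theorem mem_adjoin_self (X : GrassmannianAlephZero H) (v : H) : v ∈ (X.adjoin v).1 :=
  le_sup_right (a := X.1) (Submodule.mem_span_singleton_self v)

theorem adjoin_le_iff {X : GrassmannianAlephZero H} {v : H} {K : Submodule ℂ H} :
    (X.adjoin v).1 ≤ K ↔ X.1 ≤ K ∧ v ∈ K := by
  change X.1 ⊔ ℂ ∙ v ≤ K ↔ _
  rw [sup_le_iff, Submodule.span_singleton_le_iff_mem]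

theorem mem_adjoin {X : GrassmannianAlephZero H} {v x : H} :
    x ∈ (X.adjoin v).1 ↔ ∃ y ∈ X.1, ∃ c : ℂ, y + c • v = x := by
  change x ∈ X.1 ⊔ ℂ ∙ v ↔ _
  simp only [Submodule.mem_sup, Submodule.mem_span_singleton, exists_exists_eq_and]

theorem exists_val_eq_of_le (X : GrassmannianAlephZero H) {Y : Submodule ℂ H}
    (hc : IsClosed (Y : Set H)) (hY : ¬ FiniteDimensional ℂ Y) (hYX : Y ≤ X.1) :
    ∃ Z : GrassmannianAlephZero H, Z.1 = Y :=
  ⟨ofOrthogonal Y hc (X.2.2.1.mono hYX) hY fun _ => X.not_finiteDimensional_orthogonal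
    (Submodule.finiteDimensional_of_le (Submodule.orthogonal_le hYX)), rfl⟩

/-- Infinite-dimensional closed subspaces `Y` and `Z`, however they lie to each other, contain
orthogonal members `A` and `B` of the Grassmannian, so small that their closed sum `W` is a member
and that infinitely many dimensions are left in `Y` and `Z`. -/
theorem exists_ortho_pair {Y Z : Submodule ℂ H} (hYc : IsClosed (Y : Set H))
    (hZc : IsClosed (Z : Set H)) (hY : ¬ FiniteDimensional ℂ Y) (hZ : ¬ FiniteDimensional ℂ Z) :
    ∃ A B W : GrassmannianAlephZero H, A.1 ≤ Y ∧ B.1 ≤ Z ∧ A.1 ⟂ B.1 ∧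
      W.1 = (A.1 ⊔ B.1).topologicalClosure ∧ ¬ FiniteDimensional ℂ (Y ⊓ A.1ᗮ : Submodule ℂ H) ∧
      ¬ FiniteDimensional ℂ (Z ⊓ B.1ᗮ : Submodule ℂ H) := by
  obtain ⟨y, z, hyY, hy0, hzZ, hz0, hy, hz, hyz⟩ := exists_orthogonal_sequences hY hZ
  have hzy : ∀ m n, ⟪z m, y n⟫_ℂ = 0 := fun m n => inner_eq_zero_symm.mp (hyz n m)
  have heven : Function.Injective fun n : ℕ => 2 * n := fun m n h => by simpa using h
  have hodd : Function.Injective fun n : ℕ => 2 * n + 1 := fun m n h => by simpa using h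
  -- The even terms span the new subspaces, the odd ones witness that enough room is left.
  let y' : ℕ → H := fun n => y (2 * n)
  let z' : ℕ → H := fun n => z (2 * n)
  have hyo : ∀ n, y (2 * n + 1) ∈ (closedSpan y')ᗮ := fun n =>
    mem_orthogonal_closedSpan fun m => hy (by omega)
  have hzo : ∀ n, z (2 * n + 1) ∈ (closedSpan z')ᗮ := fun n =>
    mem_orthogonal_closedSpan fun m => hz (by omega)
  have hyzo : ∀ n, y n ∈ (closedSpan z')ᗮ := fun n =>
    mem_orthogonal_closedSpan fun m => hzy _ _
  have hy_odd : Pairwise fun m n => ⟪y (2 * m + 1), y (2 * n + 1)⟫_ℂ = 0 :=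
    fun m n h => hy (hodd.ne h)
  have hz_odd : Pairwise fun m n => ⟪z (2 * m + 1), z (2 * n + 1)⟫_ℂ = 0 :=
    fun m n h => hz (hodd.ne h)
  let A : GrassmannianAlephZero H := ofOrthogonal (closedSpan y')
    (Submodule.isClosed_topologicalClosure _) (isSeparable_closedSpan _)
    (not_finiteDimensional_of_orthogonal_sequence (mem_closedSpan y') (fun n => hy0 _)
      fun m n h => hy (heven.ne h))
    (not_finiteDimensional_of_orthogonal_sequence hyo (fun n => hy0 _) hy_odd)
  let B : GrassmannianAlephZero H := ofOrthogonal (closedSpan z')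
    (Submodule.isClosed_topologicalClosure _) (isSeparable_closedSpan _)
    (not_finiteDimensional_of_orthogonal_sequence (mem_closedSpan z') (fun n => hz0 _)
      fun m n h => hz (heven.ne h))
    (not_finiteDimensional_of_orthogonal_sequence hzo (fun n => hz0 _) hz_odd)
  let W : GrassmannianAlephZero H := ofOrthogonal (A.1 ⊔ B.1).topologicalClosure
    (Submodule.isClosed_topologicalClosure _)
    (by
      rw [Submodule.topologicalClosure_coe]
      exact (isSeparable_sup A.2.2.1 B.2.2.1).closure)
    (fun _ => A.2.2.2.1 (Submodule.finiteDimensional_of_le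
      (le_sup_left.trans (Submodule.le_topologicalClosure (A.1 ⊔ B.1)))))
    (by
      rw [Submodule.orthogonal_closure, ← Submodule.inf_orthogonal]
      exact not_finiteDimensional_of_orthogonal_sequence (fun n => ⟨hyo n, hyzo _⟩)
        (fun n => hy0 _) hy_odd)
  exact ⟨A, B, W, closedSpan_le hYc fun n => hyY _, closedSpan_le hZc fun n => hzZ _,
    closedSpan_le (Submodule.isClosed_orthogonal _) fun n => hyzo _, rfl,
    not_finiteDimensional_of_orthogonal_sequence (fun n => ⟨hyY _, hyo n⟩) (fun n => hy0 _) hy_odd,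
    not_finiteDimensional_of_orthogonal_sequence (fun n => ⟨hzZ _, hzo n⟩) (fun n => hz0 _) hz_odd⟩

theorem exists_mem_le {K : Submodule ℂ H} (hKc : IsClosed (K : Set H))
    (hK : ¬ FiniteDimensional ℂ K) {u : H} (hu : u ∈ K) :
    ∃ Z : GrassmannianAlephZero H, u ∈ Z.1 ∧ Z.1 ≤ K := by
  obtain ⟨A, -, -, hA, -⟩ := exists_ortho_pair hKc hKc hK hK
  exact ⟨A.adjoin u, A.mem_adjoin_self u, adjoin_le_iff.mpr ⟨hA, hu⟩⟩

/-- Inclusion in the Grassmannian can be expressed by orthogonality. -/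
theorem le_iff_forall_ortho {X Y : GrassmannianAlephZero H} :
    X.1 ≤ Y.1 ↔ ∀ Z : GrassmannianAlephZero H, Z.1 ⟂ Y.1 → Z.1 ⟂ X.1 := by
  refine ⟨fun h Z hZ => hZ.mono_right h, fun h => ?_⟩
  rw [← Submodule.orthogonal_orthogonal Y.1]
  intro x hx u hu
  obtain ⟨Z, huZ, hZ⟩ := exists_mem_le (Submodule.isClosed_orthogonal _)
    Y.not_finiteDimensional_orthogonal hu
  exact (h Z hZ).inner_eq huZ hx

/-- `X.adjoin v` covers `X`, unless they are equal. -/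
theorem adjoin_eq_of_le {X Z : GrassmannianAlephZero H} {v : H} (hXZ : X.1 ≤ Z.1)
    (hZ : Z.1 ≤ (X.adjoin v).1) (hne : ¬ Z.1 ≤ X.1) : Z = X.adjoin v := by
  refine Subtype.ext (le_antisymm hZ (adjoin_le_iff.mpr ⟨hXZ, ?_⟩))
  obtain ⟨z, hzZ, hzX⟩ := Set.not_subset.mp hne
  obtain ⟨x, hx, c, rfl⟩ := mem_adjoin.mp (hZ hzZ)
  have hc : c ≠ 0 := by
    rintro rfl
    exact hzX (by simpa using hx)
  have h1 : c • v ∈ Z.1 := by simpa using Z.1.sub_mem hzZ (hXZ hx)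
  exact (Submodule.smul_mem_iff _ hc).mp h1

end GrassmannianAlephZero

open GrassmannianAlephZero

/-! ### The map of lines induced by an orthogonality preserving bijection -/

section InducedLineMap

variable {H : Type*} [NormedAddCommGroup H] [InnerProductSpace ℂ H]

theorem PreservesOrthogonality.symm {e : GrassmannianAlephZero H ≃ GrassmannianAlephZero H}
    (he : PreservesOrthogonality e) : PreservesOrthogonality e.symm := fun X Y => by
  simpa only [e.apply_symm_apply] using (he (e.symm X) (e.symm Y)).symm

variable [CompleteSpace H] {e : GrassmannianAlephZero H ≃ GrassmannianAlephZero H}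

theorem PreservesOrthogonality.le_iff (he : PreservesOrthogonality e)
    {X Y : GrassmannianAlephZero H} : (e X).1 ≤ (e Y).1 ↔ X.1 ≤ Y.1 := by
  rw [le_iff_forall_ortho, le_iff_forall_ortho, ← e.forall_congr_right]
  simp only [← he _ _]

/-- The orthogonal complement of `e Y` in the image of `Y ⊔ span {v}`. For `v ≠ 0` orthogonal to `Y`
it is a line which does not depend on `Y`: the image of `span {v}` under the map of lines induced
by `e`. -/
noncomputable def lineImage (e : GrassmannianAlephZero H ≃ GrassmannianAlephZero H)
    (Y : GrassmannianAlephZero H) (v : H) : Submodule ℂ H :=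
  (e (Y.adjoin v)).1 ⊓ (e Y).1ᗮ

theorem not_adjoin_le {Y : GrassmannianAlephZero H} {v : H} (hv : v ≠ 0) (hvY : v ∈ Y.1ᗮ) :
    ¬ (Y.adjoin v).1 ≤ Y.1 := fun h =>
  hv (inner_self_eq_zero.mp (hvY v (h (Y.mem_adjoin_self v))))

theorem exists_mem_lineImage (he : PreservesOrthogonality e) {Y : GrassmannianAlephZero H} {v : H}
    (hv : v ≠ 0) (hvY : v ∈ Y.1ᗮ) : ∃ w ∈ lineImage e Y v, w ≠ 0 := by
  refine Submodule.exists_mem_ne_zero_of_ne_bot fun h0 => not_adjoin_le hv hvY ?_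
  rw [lineImage, inf_comm] at h0
  have h1 := Submodule.sup_orthogonal_inf_of_hasOrthogonalProjection
    (he.le_iff.mpr (Y.le_adjoin v))
  rw [h0, sup_bot_eq] at h1
  rw [← he.le_iff, ← h1]

/-- `e` is an order isomorphism, so there is nothing strictly between `e Y` and the image of
`Y.adjoin v`. -/
theorem adjoin_eq_of_mem_lineImage (he : PreservesOrthogonality e) {Y : GrassmannianAlephZero H}
    {v w : H} (hw : w ≠ 0) (h : w ∈ lineImage e Y v) : (e Y).adjoin w = e (Y.adjoin v) := by
  obtain ⟨Z, hZ⟩ := e.surjective ((e Y).adjoin w)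
  have hYZ : Y.1 ≤ Z.1 := by
    rw [← he.le_iff, hZ]
    exact (e Y).le_adjoin w
  have hZY : Z.1 ≤ (Y.adjoin v).1 := by
    rw [← he.le_iff, hZ, adjoin_le_iff]
    exact ⟨he.le_iff.mpr (Y.le_adjoin v), h.1⟩
  have hne : ¬ Z.1 ≤ Y.1 := by
    rw [← he.le_iff, hZ]
    exact not_adjoin_le hw h.2
  rw [← adjoin_eq_of_le hYZ hZY hne, hZ]

theorem lineImage_le_span (he : PreservesOrthogonality e) {Y : GrassmannianAlephZero H} {v w : H}
    (hw : w ≠ 0) (h : w ∈ lineImage e Y v) : lineImage e Y v ≤ ℂ ∙ w := by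
  intro w' h'
  have h1 : w' ∈ ((e Y).adjoin w).1 := by
    rw [adjoin_eq_of_mem_lineImage he hw h]; exact h'.1
  obtain ⟨y, hy, c, rfl⟩ := mem_adjoin.mp h1
  have h2 : y ∈ (e Y).1ᗮ := by
    simpa using (e Y).1ᗮ.sub_mem h'.2 ((e Y).1ᗮ.smul_mem c h.2)
  obtain rfl : y = 0 := inner_self_eq_zero.mp (h2 y hy)
  rw [zero_add]
  exact Submodule.smul_mem _ _ (Submodule.mem_span_singleton_self w)

/-- Enlarging `Y'` to `Y` by infinitely many dimensions, spanned by a member `W` orthogonal to `Y'`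
and to `v`, does not change the image of the line: the image of `W` is orthogonal to that of
`Y'.adjoin v`. -/
theorem lineImage_eq_of_le (he : PreservesOrthogonality e) {Y Y' : GrassmannianAlephZero H} {v : H}
    (hv : v ≠ 0) (hvY : v ∈ Y.1ᗮ) (hle : Y'.1 ≤ Y.1)
    (hinf : ¬ FiniteDimensional ℂ (Y.1 ⊓ Y'.1ᗮ : Submodule ℂ H)) :
    lineImage e Y' v = lineImage e Y v := by
  have hvY' : v ∈ Y'.1ᗮ := Submodule.orthogonal_le hle hvY
  obtain ⟨W, hW⟩ := Y.exists_val_eq_of_le (Y.isClosed_inf_orthogonal _) hinf inf_le_left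
  have hsup : Y'.1 ⊔ W.1 = Y.1 := by
    rw [hW, inf_comm]
    exact Submodule.sup_orthogonal_inf_of_hasOrthogonalProjection hle
  have hWv : (Y'.adjoin v).1 ⟂ W.1 := by
    refine adjoin_le_iff.mpr ⟨?_, Submodule.orthogonal_le (hW.trans_le inf_le_left) hvY⟩
    rw [← Submodule.IsOrtho, Submodule.isOrtho_comm, hW]
    exact inf_le_right
  have key : lineImage e Y' v ≤ lineImage e Y v := by
    intro w hw
    refine ⟨he.le_iff.mpr (adjoin_le_iff.mpr ⟨hle.trans (Y.le_adjoin v), Y.mem_adjoin_self v⟩)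
      hw.1, ?_⟩
    -- A member of the Grassmannian containing `w` and orthogonal to the images of `Y'` and `W`
    -- is orthogonal to the image of `Y`, because `Y` is the supremum of `Y'` and `W`.
    obtain ⟨A, -, -, hA, -⟩ := exists_ortho_pair (Submodule.isClosed_orthogonal _)
      (Submodule.isClosed_orthogonal _) (e Y).not_finiteDimensional_orthogonal
      (e Y).not_finiteDimensional_orthogonal
    obtain ⟨Z, hZ⟩ := e.surjective (A.adjoin w)
    have hWY : W.1 ≤ Y.1 := hW.trans_le inf_le_left
    have hZY' : Z.1 ⟂ Y'.1 := by
      rw [he, hZ]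
      exact adjoin_le_iff.mpr
        ⟨hA.trans (Submodule.orthogonal_le (he.le_iff.mpr hle)), hw.2⟩
    have hZW : Z.1 ⟂ W.1 := by
      rw [he, hZ]
      exact adjoin_le_iff.mpr
        ⟨hA.trans (Submodule.orthogonal_le (he.le_iff.mpr hWY)), (he _ _).mp hWv hw.1⟩
    have hZY : Z.1 ⟂ Y.1 := by
      rw [← hsup]; exact Submodule.isOrtho_sup_right.mpr ⟨hZY', hZW⟩
    rw [he, hZ] at hZY
    exact hZY (A.mem_adjoin_self w)
  refine le_antisymm key ?_
  obtain ⟨w, hw, hw0⟩ := exists_mem_lineImage he hv hvY'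
  exact (lineImage_le_span he hw0 (key hw)).trans
    ((Submodule.span_singleton_le_iff_mem _ _).mpr hw)

/-- Any two members orthogonal to `v` are connected by a chain `Y₁ ≥ A ≤ W ≥ B ≤ Y₂` of steps covered
by `lineImage_eq_of_le`. -/
theorem lineImage_eq (he : PreservesOrthogonality e) {Y₁ Y₂ : GrassmannianAlephZero H} {v : H}
    (hv : v ≠ 0) (h₁ : v ∈ Y₁.1ᗮ) (h₂ : v ∈ Y₂.1ᗮ) : lineImage e Y₁ v = lineImage e Y₂ v := by
  obtain ⟨A, B, W, hA, hB, hAB, hW, hAinf, hBinf⟩ :=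
    exists_ortho_pair Y₁.2.1 Y₂.2.1 Y₁.2.2.2.1 Y₂.2.2.2.1
  have hAW : A.1 ≤ W.1 := hW ▸ le_sup_left.trans (Submodule.le_topologicalClosure _)
  have hBW : B.1 ≤ W.1 := hW ▸ le_sup_right.trans (Submodule.le_topologicalClosure _)
  have hvW : v ∈ W.1ᗮ := by
    rw [hW, Submodule.orthogonal_closure, ← Submodule.inf_orthogonal]
    exact ⟨Submodule.orthogonal_le hA h₁, Submodule.orthogonal_le hB h₂⟩
  have hWA : ¬ FiniteDimensional ℂ (W.1 ⊓ A.1ᗮ : Submodule ℂ H) := fun _ =>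
    B.2.2.2.1 (Submodule.finiteDimensional_of_le (le_inf hBW hAB.symm))
  have hWB : ¬ FiniteDimensional ℂ (W.1 ⊓ B.1ᗮ : Submodule ℂ H) := fun _ =>
    A.2.2.2.1 (Submodule.finiteDimensional_of_le (le_inf hAW hAB))
  rw [← lineImage_eq_of_le he hv h₁ hA hAinf, lineImage_eq_of_le he hv hvW hAW hWA,
    ← lineImage_eq_of_le he hv hvW hBW hWB, lineImage_eq_of_le he hv h₂ hB hBinf]

/-- The line spanned by `w` is the image of the line spanned by `v`, as witnessed by some member `Y`
of the Grassmannian orthogonal to `v`. -/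
structure IsLineImage (e : GrassmannianAlephZero H ≃ GrassmannianAlephZero H) (v w : H) :
    Prop where
  ne_zero : v ≠ 0
  image_ne_zero : w ≠ 0
  exists_mem : ∃ Y : GrassmannianAlephZero H, v ∈ Y.1ᗮ ∧ w ∈ lineImage e Y v

namespace IsLineImage

theorem mem_lineImage (he : PreservesOrthogonality e) {v w : H} (h : IsLineImage e v w)
    {Y : GrassmannianAlephZero H} (hY : v ∈ Y.1ᗮ) : w ∈ lineImage e Y v := by
  obtain ⟨Y', hY', hw⟩ := h.exists_mem
  rwa [lineImage_eq he h.ne_zero hY hY']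

theorem symm (he : PreservesOrthogonality e) {v w : H} (h : IsLineImage e v w) :
    IsLineImage e.symm w v := by
  obtain ⟨Y, hY, hw⟩ := h.exists_mem
  refine ⟨h.image_ne_zero, h.ne_zero, e Y, hw.2, ?_⟩
  rw [lineImage, adjoin_eq_of_mem_lineImage he h.image_ne_zero hw, e.symm_apply_apply,
    e.symm_apply_apply]
  exact ⟨Y.mem_adjoin_self v, hY⟩

theorem exists_eq_smul (he : PreservesOrthogonality e) {v w w' : H} (h : IsLineImage e v w)
    (h' : IsLineImage e v w') : ∃ c : ℂ, c ≠ 0 ∧ w' = c • w := by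
  obtain ⟨Y, hY, hw⟩ := h.exists_mem
  obtain ⟨c, hc⟩ := Submodule.mem_span_singleton.mp
    (lineImage_le_span he h.image_ne_zero hw (h'.mem_lineImage he hY))
  refine ⟨c, ?_, hc.symm⟩
  rintro rfl
  exact h'.image_ne_zero (by rw [← hc, zero_smul])

/-- Take `Y = X ⊓ vᗮ`, for which `Y.adjoin v ≤ X`. -/
theorem mem_image (he : PreservesOrthogonality e) {v w : H} (h : IsLineImage e v w)
    {X : GrassmannianAlephZero H} (hv : v ∈ X.1) : w ∈ (e X).1 := by
  obtain ⟨Y, hY⟩ := X.exists_val_eq_of_le (X.isClosed_inf_orthogonal (ℂ ∙ v))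
    (not_finiteDimensional_inf_orthogonal X.2.2.2.1) inf_le_left
  have hvY : v ∈ Y.1ᗮ := by
    rw [hY]
    exact fun x hx => Submodule.mem_orthogonal_singleton_iff_inner_left.mp hx.2
  exact he.le_iff.mpr (adjoin_le_iff.mpr ⟨hY.trans_le inf_le_left, hv⟩)
    (h.mem_lineImage he hvY).1

theorem mem_image_iff (he : PreservesOrthogonality e) {v w : H} (h : IsLineImage e v w)
    {X : GrassmannianAlephZero H} : w ∈ (e X).1 ↔ v ∈ X.1 :=
  ⟨fun hw => by simpa using (h.symm he).mem_image he.symm hw, h.mem_image he⟩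

/-- The lines are enlarged to orthogonal members `A.adjoin v` and `B.adjoin v'`, whose images are
orthogonal. -/
theorem inner_eq_zero (hH : ¬ FiniteDimensional ℂ H) (he : PreservesOrthogonality e)
    {v w v' w' : H} (h : IsLineImage e v w) (h' : IsLineImage e v' w') (hvv' : ⟪v, v'⟫_ℂ = 0) :
    ⟪w, w'⟫_ℂ = 0 := by
  have : FiniteDimensional ℂ (Submodule.span ℂ {v, v'}) :=
    FiniteDimensional.span_of_finite ℂ (Set.toFinite _)
  have hinf : ¬ FiniteDimensional ℂ (Submodule.span ℂ {v, v'})ᗮ :=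
    not_finiteDimensional_orthogonal_of_finiteDimensional hH _
  obtain ⟨A, B, -, hA, hB, hAB, -⟩ := exists_ortho_pair (Submodule.isClosed_orthogonal _)
    (Submodule.isClosed_orthogonal _) hinf hinf
  have hmem : ∀ {K : Submodule ℂ H} {x : H}, K ≤ (Submodule.span ℂ {v, v'})ᗮ →
      x ∈ ({v, v'} : Set H) → x ∈ Kᗮ := fun hK hx y hy =>
    Submodule.inner_left_of_mem_orthogonal (Submodule.subset_span hx) (hK hy)
  have hsep : (A.adjoin v).1 ⟂ (B.adjoin v').1 := by
    refine adjoin_le_iff.mpr ⟨?_, ?_⟩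
    · rw [← Submodule.IsOrtho, Submodule.isOrtho_comm]
      exact adjoin_le_iff.mpr ⟨hAB.symm, hmem hA (by simp)⟩
    · rw [← Submodule.span_singleton_le_iff_mem, ← Submodule.IsOrtho, Submodule.isOrtho_comm]
      refine adjoin_le_iff.mpr ⟨?_, Submodule.mem_orthogonal_singleton_iff_inner_right.mpr hvv'⟩
      rw [← Submodule.IsOrtho, Submodule.isOrtho_comm]
      exact (Submodule.span_singleton_le_iff_mem _ _).mpr (hmem hB (by simp))
  exact ((he _ _).mp hsep).inner_eq (h.mem_lineImage he (hmem hA (by simp))).1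
    (h'.mem_lineImage he (hmem hB (by simp))).1

theorem exists_of_ne_zero (hH : ¬ FiniteDimensional ℂ H) (he : PreservesOrthogonality e)
    {v : H} (hv : v ≠ 0) : ∃ w, IsLineImage e v w := by
  have hinf : ¬ FiniteDimensional ℂ (ℂ ∙ v)ᗮ :=
    not_finiteDimensional_orthogonal_of_finiteDimensional hH _
  obtain ⟨Y, -, hY⟩ := exists_mem_le (Submodule.isClosed_orthogonal _) hinf
    (Submodule.zero_mem _)
  have hvY : v ∈ Y.1ᗮ := fun y hy =>
    Submodule.mem_orthogonal_singleton_iff_inner_left.mp (hY hy)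
  obtain ⟨w, hw, hw0⟩ := exists_mem_lineImage he hv hvY
  exact ⟨w, hv, hw0, Y, hvY, hw⟩

end IsLineImage

/-- The induced map of lines is a bijection preserving orthogonality because the bijection `e.symm`
induces its inverse; it determines `e`, as it describes which lines lie in `e X`. -/
theorem PreservesOrthogonality.exists_isOrthoBijection (hH : ¬ FiniteDimensional ℂ H)
    (he : PreservesOrthogonality e) :
    ∃ g : H → H, IsOrthoBijection g ∧
      ∀ (v : H) (X : GrassmannianAlephZero H), g v ∈ (e X).1 ↔ v ∈ X.1 := by
  have hex : ∀ v, ∃ w, (v = 0 → w = 0) ∧ (v ≠ 0 → IsLineImage e v w) := fun v => by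
    by_cases hv : v = 0
    · exact ⟨0, fun _ => rfl, fun h => absurd hv h⟩
    · obtain ⟨w, hw⟩ := IsLineImage.exists_of_ne_zero hH he hv
      exact ⟨w, fun h => absurd h hv, fun _ => hw⟩
  choose g hg0 hg using hex
  refine ⟨g, ⟨fun v w => ?_, fun w => ?_⟩, fun v X => ?_⟩
  · by_cases hv : v = 0
    · rw [hg0 v hv, hv, inner_zero_left, inner_zero_left]
    by_cases hw : w = 0
    · rw [hg0 w hw, hw, inner_zero_right, inner_zero_right]
    exact ⟨((hg v hv).symm he).inner_eq_zero hH he.symm ((hg w hw).symm he),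
      (hg v hv).inner_eq_zero hH he (hg w hw)⟩
  · by_cases hw : w = 0
    · exact ⟨0, 1, one_ne_zero, by rw [hg0 0 rfl, hw, smul_zero]⟩
    obtain ⟨v, hv⟩ := IsLineImage.exists_of_ne_zero hH he.symm hw
    have hv' : IsLineImage e v w := by simpa using hv.symm he.symm
    exact ⟨v, hv'.exists_eq_smul he (hg v hv'.ne_zero)⟩
  · by_cases hv : v = 0
    · rw [hg0 v hv, hv]
      exact iff_of_true (Submodule.zero_mem _) (Submodule.zero_mem _)
    · exact (hg v hv).mem_image_iff he

omit [CompleteSpace H] in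
theorem isInducedBy_of_surjective {U g : H → H} (hU : Function.Surjective U)
    (hUg : ∀ v, ∃ c : ℂ, c ≠ 0 ∧ U v = c • g v)
    (hg : ∀ (v : H) (X : GrassmannianAlephZero H), g v ∈ (e X).1 ↔ v ∈ X.1) :
    IsInducedBy e U := by
  have key : ∀ (v : H) (X : GrassmannianAlephZero H), U v ∈ (e X).1 ↔ v ∈ X.1 := fun v X => by
    obtain ⟨c, hc, h⟩ := hUg v
    rw [h, Submodule.smul_mem_iff _ hc, hg]
  intro X
  ext w
  constructor
  · intro hw
    obtain ⟨v, rfl⟩ := hU w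
    exact ⟨v, (key v X).mp hw, rfl⟩
  · rintro ⟨v, hv, rfl⟩
    exact (key v X).mpr hv

end InducedLineMap

theorem mainTheorem5 {H : Type*} [NormedAddCommGroup H] [InnerProductSpace ℂ H]
    [CompleteSpace H] (hH : ¬ FiniteDimensional ℂ H)
    (h : GrassmannianAlephZero H → GrassmannianAlephZero H)
    (hbij : Function.Bijective h) (horth : PreservesOrthogonality h) :
    (∃ U : H ≃ₗᵢ[ℂ] H, IsInducedBy h U) ∨ (∃ U : H ≃ₗᵢ⋆[ℂ] H, IsInducedBy h U) := by
  have he : PreservesOrthogonality (Equiv.ofBijective h hbij) := horth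
  obtain ⟨g, hg, hgmem⟩ := he.exists_isOrthoBijection hH
  rcases hg.exists_linearIsometryEquiv hH with ⟨U, hU⟩ | ⟨U, hU⟩
  · exact Or.inl ⟨U, isInducedBy_of_surjective U.surjective hU hgmem⟩
  · exact Or.inr ⟨U, isInducedBy_of_surjective U.surjective hU hgmem⟩
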